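/- Consider polygons on the unit sphere $S^2\subset\mathbb{R}^3$. For $n\ge 2$, a spherical $n$-gon $P$ is a closed curve on $S^2$ consisting of $n$ cyclically consecutive edges, each edge being an arc of a great circle of length in $(0,2\pi)$ (lengths $\ge\pi$ are allowed) that ends at the vertex where the next edge begins; $P$ also denotes the union of its (closed) edges. A polygon with $n=2$ is called a bigon. One of the two sides of $P$ (left or right with respect to a direction of traversal) is fixed as the interior side, and the interior angle at a vertex is the angle, between $0$ and $2\pi$, on that side between the two edges meeting there. A closed hemisphere is a set $H=\{x\in S^2:\langle w,x\rangle\ge 0\}$ with $|w|=1$; its interior is $\{x\in S^2:\langle w,x\rangle>0\}$ and its boundary great circle is $\partial H=\{x\in S^2:\langle w,x\rangle=0\}$. Theorem. Let $P$ be a spherical polygon that has no self-intersection (the closed curve passes through no point twice) and all of whose interior angles are less than $\pi$. Then: 1. $P$ is contained in a closed hemisphere. 2. For every edge $e$ of $P$ there is a closed hemisphere $H$ with $P\subset H$ and $e\subset\partial H$; and whenever $H$ is a closed hemisphere with $P\subset H$ and an edge $e$ of $P$ lies on $\partial H$, the rest $P\setminus e$ is contained in the interior of $H$. 3. Consequently,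 $P$ is either a bigon or contained in the interior of a closed hemisphere. -/

import Mathlib

namespace SphPoly

/-- Euclidean 3-space; the 2-sphere is its unit sphere. -/
abbrev E3 : Type := EuclideanSpace ℝ (Fin 3)

/-- The determinant of three vectors of 3-space. It is positive when `v`, `a`, `b` is a
positively oriented triple, that is, when for tangent vectors `a`, `b` at `v` the vector `b` is on
the left of `a`, seen from outside the sphere. -/
noncomputable def tripleProduct (v a b : E3) : ℝ :=
  Matrix.det (Matrix.of ![fun k => v k, fun k => a k, fun k => b k])

/-- The angle, in `[0, 2π)`, of the counterclockwise rotation (seen from outside the sphere)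
in the tangent plane at `v` that takes the unit tangent vector `a` to the unit tangent
vector `b`. -/
noncomputable def ccwAngle (v a b : E3) : ℝ :=
  let z : ℂ := ⟨inner ℝ a b, tripleProduct v a b⟩
  if 0 ≤ z.arg then z.arg else z.arg + 2 * Real.pi

/-- A spherical `n`-gon, possibly self-intersecting. The `i`-th edge is the great circle arc
that leaves the vertex `vertex i` in the unit tangent direction `dir i`, has length
`length i ∈ (0, 2π)` (so that it is embedded), and ends at `vertex (i + 1)`, the index being
cyclic. Edges of length `≥ π` are allowed. -/
structure SphericalPolygon (n : ℕ) [NeZero n] where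
  vertex : Fin n → E3
  dir : Fin n → E3
  length : Fin n → ℝ
  norm_vertex : ∀ i, ‖vertex i‖ = 1
  norm_dir : ∀ i, ‖dir i‖ = 1
  inner_vertex_dir : ∀ i, inner ℝ (vertex i) (dir i) = 0
  length_pos : ∀ i, 0 < length i
  length_lt : ∀ i, length i < 2 * Real.pi
  end_eq : ∀ i, Real.cos (length i) • vertex i + Real.sin (length i) • dir i = vertex (i + 1)

/-- The two sides of a closed curve on the oriented sphere. -/
inductive Side
  | left
  | right

namespace SphericalPolygon

variable {n : ℕ} [NeZero n]

/-- Arc length parametrization of the `i`-th edge, for `0 ≤ t ≤ P.length i`. -/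
noncomputable def point (P : SphericalPolygon n) (i : Fin n) (t : ℝ) : E3 :=
  Real.cos t • P.vertex i + Real.sin t • P.dir i

/-- Velocity of the arc length parametrization of the `i`-th edge. -/
noncomputable def velocity (P : SphericalPolygon n) (i : Fin n) (t : ℝ) : E3 :=
  -Real.sin t • P.vertex i + Real.cos t • P.dir i

/-- The `i`-th edge, as a closed arc. -/
def edge (P : SphericalPolygon n) (i : Fin n) : Set E3 :=
  P.point i '' Set.Icc 0 (P.length i)

/-- The point set of the polygon: the union of its edges. -/
def carrier (P : SphericalPolygon n) : Set E3 :=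
  ⋃ i, P.edge i

/-- No self-intersection: the closed curve that runs through the edges one after the other
visits no point twice. (Each edge is taken without its end point, which is the initial point
of the next edge.) -/
def IsSimple (P : SphericalPolygon n) : Prop :=
  ∀ i j : Fin n, ∀ s ∈ Set.Ico 0 (P.length i), ∀ t ∈ Set.Ico 0 (P.length j),
    P.point i s = P.point j t → i = j ∧ s = t

/-- The unit tangent vector at the `i`-th vertex that points back along the preceding edge. -/
noncomputable def backDir (P : SphericalPolygon n) (i : Fin n) : E3 :=
  -P.velocity (i - 1) (P.length (i - 1))

/-- The interior angle at the `i`-th vertex, once a side of the polygon is fixed as its interior.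
On the left side it is the angle from the outgoing edge counterclockwise to the
incoming edge; the angles of the two sides add up to `2π`. -/
noncomputable def interiorAngle (P : SphericalPolygon n) (side : Side) (i : Fin n) : ℝ :=
  match side with
  | Side.left => ccwAngle (P.vertex i) (P.dir i) (P.backDir i)
  | Side.right => 2 * Real.pi - ccwAngle (P.vertex i) (P.dir i) (P.backDir i)

/-- A bigon is a polygon with exactly two edges. -/
def IsBigon (_P : SphericalPolygon n) : Prop := n = 2

end SphericalPolygon

/-- The closed hemisphere with pole `w`. -/
def closedHemisphere (w : E3) : Set E3 :=
  {x | ‖x‖ = 1 ∧ 0 ≤ inner ℝ w x}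

/-- The open hemisphere with pole `w`, the interior of the closed one. -/
def openHemisphere (w : E3) : Set E3 :=
  {x | ‖x‖ = 1 ∧ 0 < inner ℝ w x}

/-- The great circle with pole `w`, the boundary of the hemisphere with pole `w`. -/
def greatCircle (w : E3) : Set E3 :=
  {x | ‖x‖ = 1 ∧ inner ℝ w x = 0}

end SphPoly

/-! ### Determinants and orthonormal frames in 3-space. -/

namespace SphPoly

/-! Fix an edge e on a great circle C and walk along the polygon, starting with e. Angles less than
π make every turn go to the same side, so each edge passed adds a half-space in which the walk
continues. By `TurningWalk.Confined`, the walk can leave the intersection of these half-spaces only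
through C or through edges already traversed. A simple curve cannot meet its own trace, so only C is
left as an exit.

Suppose that the walk returns to C at a point x before closing up (`SimpleClosed.false_of_hit`).
Simplicity puts x off e. The half-space conditions at x then force x onto the open half of C
opposite to the direction in which e starts, and they put the initial vertex of e strictly inside
the half-spaces of all the edges passed after e (`height_vertex_zero_pos`). Now run through the
polygon backwards from e. This reversed walk enters the region enclosed by the arc traversed so far,
cannot cross that arc, and has to arrive at x from inside. It also stays on the inner side of the
edge preceding e, whereas x is strictly on the outer side: a contradiction. Hence the polygon minus
e is strictly on the inner side of C (`SimpleClosed.height_zero_pos_of_notMem_edge`,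
`inner_pole_pos`).

The pole of C on the inner side gives the supporting hemisphere, and a great circle determines its
pole up to sign. With at least three edges no point lies on all of them, so the sum of the poles is
positive on the whole polygon. -/

theorem tripleProduct_eq (v a b : E3) :
    tripleProduct v a b = v 0 * a 1 * b 2 - v 0 * a 2 * b 1 - v 1 * a 0 * b 2
      + v 1 * a 2 * b 0 + v 2 * a 0 * b 1 - v 2 * a 1 * b 0 := by
  simp [tripleProduct, Matrix.det_fin_three]

theorem inner_eq (a b : E3) : inner ℝ a b = a 0 * b 0 + a 1 * b 1 + a 2 * b 2 := by
  simp [PiLp.inner_apply, Fin.sum_univ_three, mul_comm]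

theorem tripleProduct_add_smul (v a x y : E3) (p q : ℝ) :
    tripleProduct v a (p • x + q • y) = p * tripleProduct v a x + q * tripleProduct v a y := by
  simp [tripleProduct_eq]; ring

theorem tripleProduct_neg (v a x : E3) : tripleProduct v a (-x) = -tripleProduct v a x := by
  simp [tripleProduct_eq]; ring

theorem tripleProduct_self_left (v a : E3) : tripleProduct v a v = 0 := by
  simp [tripleProduct_eq]; ring

theorem tripleProduct_self_right (v a : E3) : tripleProduct v a a = 0 := by
  simp [tripleProduct_eq]; ring

theorem tripleProduct_self_fst_snd (v a : E3) : tripleProduct v v a = 0 := by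
  simp [tripleProduct_eq]; ring

theorem tripleProduct_swap (v a b : E3) : tripleProduct v b a = -tripleProduct v a b := by
  simp [tripleProduct_eq]; ring

theorem tripleProduct_cyclic (v a b : E3) : tripleProduct a b v = tripleProduct v a b := by
  simp [tripleProduct_eq]; ring

theorem tripleProduct_reverse (v a b : E3) : tripleProduct b a v = -tripleProduct v a b := by
  simp [tripleProduct_eq]; ring

theorem tripleProduct_add_smul_middle (v x y b : E3) (p q : ℝ) :
    tripleProduct v (p • x + q • y) b = p * tripleProduct v x b + q * tripleProduct v y b := by
  simp [tripleProduct_eq]; ring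

/-- Rotating the frame of an oriented plane does not change its determinant with a vector. -/
theorem tripleProduct_rotate (v a b : E3) (t : ℝ) :
    tripleProduct (Real.cos t • v + Real.sin t • a) (-Real.sin t • v + Real.cos t • a) b
      = tripleProduct v a b := by
  have h := Real.sin_sq_add_cos_sq t
  simp [tripleProduct_eq]
  linear_combination (v 0 * a 1 * b 2 - v 0 * a 2 * b 1 - v 1 * a 0 * b 2
      + v 1 * a 2 * b 0 + v 2 * a 0 * b 1 - v 2 * a 1 * b 0) * h

@[fun_prop]
theorem continuous_tripleProduct (v a : E3) : Continuous (tripleProduct v a) := by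
  have : tripleProduct v a = fun b => _ := funext (tripleProduct_eq v a)
  rw [this]
  fun_prop

/-- The Gram determinant of an orthonormal pair and a third vector. -/
theorem sq_tripleProduct {v a : E3} (hv : ‖v‖ = 1) (ha : ‖a‖ = 1) (hva : inner ℝ v a = 0)
    (y : E3) :
    tripleProduct v a y ^ 2 = inner ℝ y y - inner ℝ v y ^ 2 - inner ℝ a y ^ 2 := by
  have hv' : inner ℝ v v = (1 : ℝ) := by rw [real_inner_self_eq_norm_sq, hv]; norm_num
  have ha' : inner ℝ a a = (1 : ℝ) := by rw [real_inner_self_eq_norm_sq, ha]; norm_num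
  have gram : tripleProduct v a y ^ 2 = inner ℝ v v * inner ℝ a a * inner ℝ y y
      + 2 * inner ℝ v a * inner ℝ a y * inner ℝ v y - inner ℝ v v * inner ℝ a y ^ 2
      - inner ℝ a a * inner ℝ v y ^ 2 - inner ℝ y y * inner ℝ v a ^ 2 := by
    simp only [tripleProduct_eq, inner_eq]; ring
  rw [gram, hv', ha', hva]; ring

/-- A product of two determinants is the determinant of the matrix of mutual inner products; here
only one entry off the orthonormal block survives. It shows that the pole of a great circle is
unique up to sign. -/
theorem tripleProduct_mul_of_orthogonal {v a : E3} (hv : ‖v‖ = 1) (ha : ‖a‖ = 1)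
    (hva : inner ℝ v a = 0) {w : E3} (hwv : inner ℝ w v = 0) (hwa : inner ℝ w a = 0) (y : E3) :
    tripleProduct v a w * tripleProduct v a y = inner ℝ w y := by
  have hv' : inner ℝ v v = (1 : ℝ) := by rw [real_inner_self_eq_norm_sq, hv]; norm_num
  have ha' : inner ℝ a a = (1 : ℝ) := by rw [real_inner_self_eq_norm_sq, ha]; norm_num
  have gram : tripleProduct v a w * tripleProduct v a y =
      inner ℝ v v * (inner ℝ a a * inner ℝ w y - inner ℝ w a * inner ℝ a y)
      - inner ℝ v a * (inner ℝ v a * inner ℝ w y - inner ℝ w v * inner ℝ a y)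
      + inner ℝ v y * (inner ℝ v a * inner ℝ w a - inner ℝ w v * inner ℝ a a) := by
    simp only [tripleProduct_eq, inner_eq]; ring
  rw [gram, hv', ha', hva, hwv, hwa]; ring

/-- By `sq_tripleProduct`, the squared determinant is the squared distance of `y` from its
projection to the plane of `v` and `a`. -/
theorem eq_of_tripleProduct_eq_zero {v a : E3} (hv : ‖v‖ = 1) (ha : ‖a‖ = 1)
    (hva : inner ℝ v a = 0) {y : E3} (hy : tripleProduct v a y = 0) :
    y = inner ℝ v y • v + inner ℝ a y • a := by
  have h := sq_tripleProduct hv ha hva y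
  rw [hy] at h
  have hav : inner ℝ a v = (0 : ℝ) := by rw [real_inner_comm]; exact hva
  rw [← sub_eq_zero, ← norm_eq_zero, ← sq_eq_zero_iff, ← real_inner_self_eq_norm_sq]
  simp only [inner_sub_left, inner_sub_right, inner_add_left, inner_add_right, inner_smul_left,
    inner_smul_right, real_inner_self_eq_norm_sq v, real_inner_self_eq_norm_sq a, hv, ha, hva, hav,
    real_inner_comm v y, real_inner_comm a y, RCLike.conj_to_real]
  linarith

theorem exists_angle_of_tripleProduct_eq_zero {v a : E3} (hv : ‖v‖ = 1) (ha : ‖a‖ = 1)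
    (hva : inner ℝ v a = 0) {y : E3} (hy : tripleProduct v a y = 0) (hy1 : ‖y‖ = 1) :
    ∃ t, 0 ≤ t ∧ t < 2 * Real.pi ∧ y = Real.cos t • v + Real.sin t • a := by
  have h := sq_tripleProduct hv ha hva y
  rw [hy, real_inner_self_eq_norm_sq, hy1] at h
  set z : ℂ := ⟨inner ℝ v y, inner ℝ a y⟩ with hz
  have hz1 : ‖z‖ = 1 := by
    rw [← sq_eq_sq₀ (norm_nonneg _) zero_le_one, ← Complex.normSq_eq_norm_sq, Complex.normSq_mk]
    linarith
  have hz0 : z ≠ 0 := by rw [← norm_ne_zero_iff, hz1]; norm_num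
  have hc := Complex.cos_arg hz0
  have hs := Complex.sin_arg z
  rw [hz1, div_one] at hc hs
  have key := eq_of_tripleProduct_eq_zero hv ha hva hy
  by_cases h0 : 0 ≤ z.arg
  · exact ⟨z.arg, h0, by linarith [Complex.arg_le_pi z, Real.pi_pos], by rw [hc, hs]; exact key⟩
  · refine ⟨z.arg + 2 * Real.pi, by linarith [Complex.neg_pi_lt_arg z, Real.pi_pos],
      by linarith, ?_⟩
    rw [Real.cos_add_two_pi, Real.sin_add_two_pi, hc, hs]; exact key

end SphPoly

/-! ### Walks that always turn to the same side, and their confinement. -/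

namespace SphPoly

/-- A walk along great circle arcs that always turns to the same side: to the left if the
orientation `σ` is positive, to the right if it is negative. -/
structure TurningWalk where
  vertex : ℕ → E3
  dir : ℕ → E3
  length : ℕ → ℝ
  σ : ℝ
  norm_vertex : ∀ k, ‖vertex k‖ = 1
  norm_dir : ∀ k, ‖dir k‖ = 1
  inner_vertex_dir : ∀ k, inner ℝ (vertex k) (dir k) = 0
  length_pos : ∀ k, 0 < length k
  length_lt : ∀ k, length k < 2 * Real.pi
  end_eq : ∀ k, Real.cos (length k) • vertex k + Real.sin (length k) • dir k = vertex (k + 1)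
  turn : ∀ k, 0 < σ * tripleProduct (vertex k) (dir k) (dir (k + 1))

namespace TurningWalk

open Set

variable (W : TurningWalk)

/-- Arc length parametrization of the `k`-th edge. -/
noncomputable def point (k : ℕ) (t : ℝ) : E3 :=
  Real.cos t • W.vertex k + Real.sin t • W.dir k

/-- The `k`-th edge, as a closed arc. -/
def edge (k : ℕ) : Set E3 := W.point k '' Icc 0 (W.length k)

/-- The linear functional that vanishes on the great circle of the `k`-th edge and is positive on
the side to which the walk turns. -/
noncomputable def height (k : ℕ) (y : E3) : ℝ := W.σ * tripleProduct (W.vertex k) (W.dir k) y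

theorem point_zero (k : ℕ) : W.point k 0 = W.vertex k := by simp [point]

theorem point_length (k : ℕ) : W.point k (W.length k) = W.vertex (k + 1) := W.end_eq k

theorem point_pi (k : ℕ) : W.point k Real.pi = -W.vertex k := by simp [point]

@[fun_prop]
theorem continuous_point (k : ℕ) : Continuous (W.point k) := by
  unfold point; fun_prop

@[fun_prop]
theorem continuous_height (k : ℕ) : Continuous (W.height k) := by
  unfold height; fun_prop

theorem height_add_smul (k : ℕ) (p q : ℝ) (x y : E3) :
    W.height k (p • x + q • y) = p * W.height k x + q * W.height k y := by
  simp only [height, tripleProduct_add_smul]; ring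

theorem height_point (j k : ℕ) (t : ℝ) : W.height j (W.point k t)
    = Real.cos t * W.height j (W.vertex k) + Real.sin t * W.height j (W.dir k) :=
  W.height_add_smul _ _ _ _ _

theorem height_neg (k : ℕ) (y : E3) : W.height k (-y) = -W.height k y := by
  simp [height, tripleProduct_neg]

theorem height_vertex (k : ℕ) : W.height k (W.vertex k) = 0 := by
  simp [height, tripleProduct_self_left]

theorem height_dir (k : ℕ) : W.height k (W.dir k) = 0 := by
  simp [height, tripleProduct_self_right]

theorem height_point_self (k : ℕ) (t : ℝ) : W.height k (W.point k t) = 0 := by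
  simp [height_point, height_vertex, height_dir]

theorem height_vertex_succ (k : ℕ) : W.height k (W.vertex (k + 1)) = 0 := by
  rw [← point_length, height_point_self]

theorem height_dir_succ_pos (k : ℕ) : 0 < W.height k (W.dir (k + 1)) := W.turn k

theorem height_point_succ (k : ℕ) (t : ℝ) :
    W.height k (W.point (k + 1) t) = Real.sin t * W.height k (W.dir (k + 1)) := by
  simp [height_point, height_vertex_succ]

/-- The counterpart of `height_point_succ`, with the edge seen from its end. The signs of the two
sines decide whether a point of a great circle lies on the edge itself. -/
theorem height_succ_point (k : ℕ) (t : ℝ) : W.height (k + 1) (W.point k t)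
    = Real.sin (W.length k - t) * W.height k (W.dir (k + 1)) := by
  set L := W.length k
  have h := tripleProduct_rotate (W.vertex k) (W.dir k) (W.dir (k + 1)) L
  have e : W.point k t = Real.cos (L - t) • W.vertex (k + 1) + (-Real.sin (L - t)) •
      (-Real.sin L • W.vertex k + Real.cos L • W.dir k) := by
    rw [← W.end_eq k, point, Real.cos_sub, Real.sin_sub]
    have h := Real.sin_sq_add_cos_sq L
    match_scalars
    · linear_combination (-Real.cos t) * h
    · linear_combination (-Real.sin t) * h
  rw [W.end_eq k] at h
  rw [e, height_add_smul, height_vertex, height, height, tripleProduct_swap, h]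
  ring

theorem norm_point (k : ℕ) (t : ℝ) : ‖W.point k t‖ = 1 := by
  have h := norm_add_sq_real (Real.cos t • W.vertex k) (Real.sin t • W.dir k)
  rw [inner_smul_left, inner_smul_right, W.inner_vertex_dir, norm_smul, norm_smul, W.norm_vertex,
    W.norm_dir] at h
  simp only [mul_one, Real.norm_eq_abs, sq_abs, mul_zero, add_zero, Real.cos_sq_add_sin_sq] at h
  change ‖W.point k t‖ ^ 2 = _ at h
  exact (pow_eq_one_iff_of_nonneg (norm_nonneg _) two_ne_zero).1 h

theorem σ_ne_zero : W.σ ≠ 0 := by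
  intro h
  have := W.turn 0
  simp [h] at this

theorem exists_point_of_height_eq_zero {k : ℕ} {y : E3} (hy : W.height k y = 0)
    (hy1 : ‖y‖ = 1) : ∃ t, 0 ≤ t ∧ t < 2 * Real.pi ∧ y = W.point k t :=
  exists_angle_of_tripleProduct_eq_zero (W.norm_vertex k) (W.norm_dir k) (W.inner_vertex_dir k)
    ((mul_eq_zero.1 hy).resolve_left W.σ_ne_zero) hy1

/-- The walk, at the end of its `k`-th edge and about to turn into the next one, is in the open
set `U`, and cannot leave the part of the closed set `N` on the inner side of the `k`-th edge
without meeting the barrier `B`. -/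
structure Confined (k : ℕ) (N U B : Set E3) : Prop where
  isClosed : IsClosed N
  isOpen : IsOpen U
  subset : U ⊆ N
  vertex_mem : W.vertex (k + 1) ∈ U
  barrier : ∀ y, ‖y‖ = 1 → y ∈ N → y ∉ U → 0 < W.height k y → y ∈ B
  barrier_line : ∀ y, ‖y‖ = 1 → y ∈ N → W.height k y = 0 → 0 < W.height (k + 1) y → y ∈ B
  barrier_antipode : -W.vertex (k + 1) ∈ N → -W.vertex (k + 1) ∈ B

variable {W}

namespace Confined

variable {k : ℕ} {N U B : Set E3}

theorem mem_of_le_pi (h : W.Confined k N U B) {T : ℝ} (hT : T ≤ Real.pi)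
    (hB : ∀ t, 0 < t → t ≤ T → W.point (k + 1) t ∉ B) :
    ∀ t, 0 ≤ t → t ≤ T → W.point (k + 1) t ∈ U := by
  by_contra! hbad
  obtain ⟨t₁, h0, h1, ht₁⟩ := hbad
  -- Take the first exit time from `U`. Up to it the edge is in `U ⊆ N`, so the exit point is still
  -- in the closed set `N` and must be on the barrier.
  have hcomp : IsCompact (Icc 0 t₁ ∩ W.point (k + 1) ⁻¹' Uᶜ) :=
    isCompact_Icc.inter_right (h.isOpen.isClosed_compl.preimage (W.continuous_point _))
  obtain ⟨t, ⟨⟨ht0, htt⟩, htU⟩, hmin⟩ := hcomp.exists_isLeast ⟨t₁, ⟨h0, le_rfl⟩, ht₁⟩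
  have hpos : 0 < t := by
    rcases ht0.eq_or_lt with rfl | h'
    · exact absurd (by rw [W.point_zero]; exact h.vertex_mem) htU
    · exact h'
  have hN : W.point (k + 1) t ∈ N := by
    have hcl : t ∈ closure (Ioo 0 t) := by
      rw [closure_Ioo hpos.ne]; exact ⟨hpos.le, le_rfl⟩
    refine h.isClosed.closure_subset_iff.2 ?_
      (image_closure_subset_closure_image (W.continuous_point (k + 1)) ⟨t, hcl, rfl⟩)
    rintro _ ⟨s, ⟨hs0, hst⟩, rfl⟩
    by_contra hs
    exact absurd (hmin ⟨⟨hs0.le, by linarith⟩, fun hU => hs (h.subset hU)⟩) (not_le.2 hst)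
  refine hB t hpos (htt.trans h1) ?_
  -- At `π` the edge is back on the great circle of the previous edge, where `barrier` does not
  -- apply; hence the separate condition on the antipode.
  rcases (htt.trans (h1.trans hT)).eq_or_lt with rfl | hlt
  · rw [W.point_pi] at hN ⊢
    exact h.barrier_antipode hN
  · refine h.barrier _ (W.norm_point _ _) hN htU ?_
    rw [W.height_point_succ]
    exact mul_pos (Real.sin_pos_of_pos_of_lt_pi hpos hlt) (W.height_dir_succ_pos k)

/-- As long as the next edge does not meet the barrier, it is shorter than `π` and stays inside. -/
theorem lt_pi (h : W.Confined k N U B) {T : ℝ}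
    (hB : ∀ t, 0 < t → t ≤ T → W.point (k + 1) t ∉ B) : T < Real.pi := by
  by_contra! hT
  have := h.mem_of_le_pi le_rfl (fun t h0 h1 => hB t h0 (h1.trans hT)) Real.pi Real.pi_pos.le le_rfl
  refine hB Real.pi Real.pi_pos hT ?_
  rw [W.point_pi] at this ⊢
  exact h.barrier_antipode (h.subset this)

theorem mem (h : W.Confined k N U B) {t : ℝ} (ht : 0 < t)
    (hB : ∀ s, 0 < s → s ≤ t → W.point (k + 1) s ∉ B) :
    W.point (k + 1) t ∈ U ∧ 0 < W.height k (W.point (k + 1) t) := by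
  have hlt := h.lt_pi hB
  refine ⟨h.mem_of_le_pi hlt.le hB t ht.le le_rfl, ?_⟩
  rw [W.height_point_succ]
  exact mul_pos (Real.sin_pos_of_pos_of_lt_pi ht hlt) (W.height_dir_succ_pos k)

/-- The point where the next edge meets the barrier first is still in the closed region. -/
theorem mem_closed (h : W.Confined k N U B) {T : ℝ} (hT : 0 < T)
    (hB : ∀ s, 0 < s → s < T → W.point (k + 1) s ∉ B) :
    W.point (k + 1) T ∈ N ∧ 0 ≤ W.height k (W.point (k + 1) T) := by
  have hcl : T ∈ closure (Ioo 0 T) := by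
    rw [closure_Ioo hT.ne]; exact ⟨hT.le, le_rfl⟩
  have hc : IsClosed (N ∩ {y | 0 ≤ W.height k y}) :=
    h.isClosed.inter (isClosed_le continuous_const (W.continuous_height k))
  refine hc.closure_subset_iff.2 ?_
      (image_closure_subset_closure_image (W.continuous_point (k + 1)) ⟨T, hcl, rfl⟩)
  rintro _ ⟨s, ⟨hs0, hst⟩, rfl⟩
  obtain ⟨h1, h2⟩ := h.mem hs0 (fun r hr hrs => hB r hr (by linarith))
  exact ⟨h.subset h1, h2.le⟩

/-- If the next edge does not meet the barrier, the walk is confined to a smaller region at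
its end, and the edge becomes part of the barrier. -/
theorem succ (h : W.Confined k N U B)
    (hB : ∀ t, 0 < t → t ≤ W.length (k + 1) → W.point (k + 1) t ∉ B) :
    W.Confined (k + 1) (N ∩ {y | 0 ≤ W.height k y}) (U ∩ {y | 0 < W.height k y})
      (B ∪ W.edge (k + 1)) where
  isClosed := h.isClosed.inter (isClosed_le continuous_const (W.continuous_height k))
  isOpen := h.isOpen.inter (isOpen_lt continuous_const (W.continuous_height k))
  subset := inter_subset_inter h.subset fun _ hy => le_of_lt (α := ℝ) hy
  vertex_mem := by
    have := h.mem (W.length_pos (k + 1)) hB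
    rwa [W.point_length] at this
  barrier := by
    rintro y hy ⟨hN, h0⟩ hU hpos
    left
    rcases (show (0 : ℝ) ≤ _ from h0).eq_or_lt with h0 | h0
    · exact h.barrier_line y hy hN h0.symm hpos
    · exact h.barrier y hy hN (fun hyU => hU ⟨hyU, h0⟩) h0
  barrier_line := by
    rintro y hy ⟨hN, h0⟩ hline hpos
    right
    obtain ⟨t, ht0, ht2, rfl⟩ := W.exists_point_of_height_eq_zero hline hy
    have h0' : 0 ≤ W.height k (W.point (k + 1) t) := h0
    rw [W.height_point_succ] at h0'
    rw [W.height_succ_point] at hpos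
    -- The sign of `sin t` gives `t ≤ π`; as the edge is shorter than `π`, the sign of `sin (length
    -- - t)` then excludes parameters beyond its end.
    have hs := nonneg_of_mul_nonneg_left h0' (W.height_dir_succ_pos k)
    have hs' := pos_of_mul_pos_left hpos (W.height_dir_succ_pos (k + 1)).le
    have hL := h.lt_pi hB
    have hL0 := W.length_pos (k + 1)
    refine ⟨t, ⟨ht0, ?_⟩, rfl⟩
    by_contra! hlt
    have htpi : t ≤ Real.pi := by
      by_contra! hpi
      have : Real.sin (t - Real.pi) > 0 :=
        Real.sin_pos_of_pos_of_lt_pi (by linarith) (by linarith)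
      rw [Real.sin_sub_pi] at this
      linarith
    have : 0 ≤ Real.sin (t - W.length (k + 1)) :=
      Real.sin_nonneg_of_nonneg_of_le_pi (by linarith) (by linarith)
    rw [← neg_sub, Real.sin_neg] at hs'
    linarith
  barrier_antipode := by
    rintro ⟨-, h0⟩
    have := (h.mem (W.length_pos (k + 1)) hB).2
    rw [W.point_length] at this
    have h0' : 0 ≤ W.height k (-W.vertex (k + 1 + 1)) := h0
    rw [W.height_neg] at h0'
    linarith

theorem iterate (h : W.Confined 0 N U B) (m : ℕ)
    (hB : ∀ k < m, ∀ t, 0 < t → t ≤ W.length (k + 1) →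
      W.point (k + 1) t ∉ B ∧ ∀ j < k, W.point (k + 1) t ∉ W.edge (j + 1)) :
    W.Confined m (N ∩ {y | ∀ i < m, 0 ≤ W.height i y}) (U ∩ {y | ∀ i < m, 0 < W.height i y})
      (B ∪ {y | ∃ j < m, y ∈ W.edge (j + 1)}) := by
  induction m with
  | zero => simpa using h
  | succ m ih =>
    have := (ih fun k hk => hB k (by omega)).succ (by
      rintro t ht0 htL (hb | ⟨j, hj, hb⟩)
      · exact (hB m (by omega) t ht0 htL).1 hb
      · exact (hB m (by omega) t ht0 htL).2 j hj hb)
    convert this using 1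
    · ext y; simp only [mem_inter_iff, mem_ofPred_eq, Nat.forall_lt_succ_right, and_assoc]
    · ext y; simp only [mem_inter_iff, mem_ofPred_eq, Nat.forall_lt_succ_right, and_assoc]
    · ext y; simp only [mem_union, mem_ofPred_eq, Nat.exists_lt_succ_right, or_assoc]

end Confined

end TurningWalk

end SphPoly

/-! ### Simple closed walks stay on the inner side of their initial edge. -/

namespace SphPoly

namespace TurningWalk

open Set

variable {W W' : TurningWalk} {n : ℕ}

/-- The first `n` edges of the walk form a simple closed curve. -/
structure SimpleClosed (W : TurningWalk) (n : ℕ) : Prop where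
  simple : ∀ i < n, ∀ j < n, ∀ s ∈ Ico 0 (W.length i), ∀ t ∈ Ico 0 (W.length j),
    W.point i s = W.point j t → i = j ∧ s = t
  closed : W.vertex n = W.vertex 0

theorem zero_mem_Ico (W : TurningWalk) (k : ℕ) : (0 : ℝ) ∈ Ico 0 (W.length k) :=
  ⟨le_rfl, W.length_pos k⟩

/-- Every point of the curve is at a place where a half-open edge is, this edge being the same or
the next one. -/
theorem SimpleClosed.exists_eq_point (hW : W.SimpleClosed n) {k : ℕ} (hk : k < n) {t : ℝ}
    (ht : t ∈ Icc 0 (W.length k)) :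
    ∃ q < n, ∃ s ∈ Ico 0 (W.length q), W.point k t = W.point q s ∧
      ((q = k ∧ s = t ∧ t < W.length k) ∨
        (s = 0 ∧ t = W.length k ∧ ((q = k + 1) ∨ (q = 0 ∧ k + 1 = n)))) := by
  rcases ht.2.lt_or_eq with h | rfl
  · exact ⟨k, hk, t, ⟨ht.1, h⟩, rfl, Or.inl ⟨rfl, rfl, h⟩⟩
  · rcases Nat.lt_or_ge (k + 1) n with h | h
    · exact ⟨k + 1, h, 0, W.zero_mem_Ico _, by rw [W.point_length, W.point_zero],
        Or.inr ⟨rfl, rfl, Or.inl rfl⟩⟩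
    · have h' : k + 1 = n := by omega
      exact ⟨0, by omega, 0, W.zero_mem_Ico _, by
        rw [W.point_length, W.point_zero, h', hW.closed], Or.inr ⟨rfl, rfl, Or.inr ⟨rfl, h'⟩⟩⟩

/-- The initial edge is left out because the closing edge ends on it, and `t = 0` because
consecutive edges share a vertex. -/
theorem SimpleClosed.point_notMem_edge (hW : W.SimpleClosed n) {j k : ℕ} (hj : 1 ≤ j) (hjk : j < k)
    (hk : k < n) {t : ℝ} (ht0 : 0 < t) (ht : t ≤ W.length k) : W.point k t ∉ W.edge j := by
  rintro ⟨s, hs, h⟩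
  obtain ⟨q, hq, s', hs', e, hc⟩ := hW.exists_eq_point hk ⟨ht0.le, ht⟩
  obtain ⟨q₁, hq₁, s₁, hs₁, e₁, hc₁⟩ := hW.exists_eq_point (hjk.trans hk) hs
  obtain ⟨h1, h2⟩ := hW.simple q₁ hq₁ q hq s₁ hs₁ s' hs' (by rw [← e, ← e₁, h])
  rcases hc with ⟨rfl, rfl, -⟩ | ⟨-, -, rfl | ⟨rfl, -⟩⟩ <;>
    rcases hc₁ with ⟨rfl, rfl, -⟩ | ⟨h0, -, rfl | ⟨rfl, h3⟩⟩ <;> first | omega | linarith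

/-- Before the first turn there is no constraint: the great circle of the initial edge enters as a
barrier only. -/
theorem confined_zero (W : TurningWalk) :
    W.Confined 0 univ univ {y | W.height 0 y = 0} where
  isClosed := isClosed_univ
  isOpen := isOpen_univ
  subset := subset_rfl
  vertex_mem := mem_univ _
  barrier := fun _ _ _ h => absurd (mem_univ _) h
  barrier_line := fun _ _ _ h _ => h
  barrier_antipode := fun _ => by
    change W.height 0 _ = 0
    rw [W.height_neg, W.height_vertex_succ, neg_zero]

/-- A simple closed walk is confined by the great circle of its initial edge and by its own
trace, up to the moment when it meets this circle. -/
theorem SimpleClosed.confined (hW : W.SimpleClosed n) {m : ℕ} (hm : m < n)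
    (hC : ∀ k < m, ∀ t, 0 < t → t ≤ W.length (k + 1) → W.height 0 (W.point (k + 1) t) ≠ 0) :
    W.Confined m {y | ∀ i < m, 0 ≤ W.height i y} {y | ∀ i < m, 0 < W.height i y}
      ({y | W.height 0 y = 0} ∪ {y | ∃ j < m, y ∈ W.edge (j + 1)}) := by
  have := W.confined_zero.iterate m fun k hk t ht0 ht => ⟨hC k hk t ht0 ht, fun j hj =>
    hW.point_notMem_edge (by omega) (by omega) (by omega) ht0 ht⟩
  simpa only [univ_inter] using this

/-- A point on the great circle of the initial edge, off this edge, at which the walk may arrive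
from the inside, is seen together with the initial vertex. -/
theorem height_vertex_zero_pos (W : TurningWalk) {m : ℕ} (hm : 1 ≤ m) {θ : ℝ}
    (hθ : W.length 0 < θ) (hθ' : θ < 2 * Real.pi)
    (hx : ∀ i, 1 ≤ i → i ≤ m → 0 ≤ W.height i (W.point 0 θ))
    (hv : ∀ i, 2 ≤ i → i ≤ m → 0 < W.height 0 (W.vertex i)) :
    Real.sin θ < 0 ∧ W.length 0 < Real.pi ∧
      ∀ i, 1 ≤ i → i ≤ m → 0 < W.height i (W.vertex 0) := by
  have hL := W.length_pos 0
  have h1 := hx 1 le_rfl hm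
  have hc := W.height_dir_succ_pos 0
  rw [W.height_succ_point] at h1
  have hsin := nonneg_of_mul_nonneg_left h1 hc
  -- The point is off the initial edge and on the inner side of edge 1, hence at least a half turn
  -- beyond the end of the initial edge.
  have hge : Real.pi ≤ θ - W.length 0 := by
    by_contra! hlt
    have := Real.sin_pos_of_pos_of_lt_pi (x := θ - W.length 0) (by linarith) hlt
    rw [← neg_sub, Real.sin_neg] at this
    linarith
  have hs : Real.sin θ < 0 := by
    have := Real.sin_pos_of_pos_of_lt_pi (x := θ - Real.pi) (by linarith) (by linarith)
    rw [Real.sin_sub_pi] at this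
    linarith
  refine ⟨hs, by linarith, fun i hi => ?_⟩
  induction i, hi using Nat.le_induction with
  | base =>
    intro _
    rw [← W.point_zero, W.height_succ_point, sub_zero]
    exact mul_pos (Real.sin_pos_of_pos_of_lt_pi hL (by linarith)) hc
  | succ k hk ih =>
    intro hkm
    have ihk := ih (by omega)
    have hck := W.height_dir_succ_pos k
    have hv0 := hv (k + 1) (by omega) hkm
    have hxk := hx k hk (by omega)
    have hxk1 := hx (k + 1) (by omega) hkm
    have e0 := W.height_point (k + 1) 0 θ
    have key : ∀ z, W.height (k + 1) z = 0 → ∃ p q : ℝ,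
        z = p • W.vertex (k + 1) + q • W.dir (k + 1) ∧
          W.height k z = q * W.height k (W.dir (k + 1)) := by
      intro z hz
      have := eq_of_tripleProduct_eq_zero (W.norm_vertex (k + 1)) (W.norm_dir (k + 1))
        (W.inner_vertex_dir (k + 1)) ((mul_eq_zero.1 hz).resolve_left W.σ_ne_zero)
      refine ⟨_, _, this, ?_⟩
      conv_lhs => rw [this]
      rw [height_add_smul, height_vertex_succ]; ring
    by_contra! ha
    rcases ha.lt_or_eq with ha | ha
    -- If the initial vertex were strictly outside edge `k + 1`, this nonnegative combination of it
    -- and the point would lie in the plane of that edge. Edge `k` gives `0 ≤ q`, while a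
    -- determinant with the initial vertex gives `q = sin θ * height 0 (vertex (k + 1)) < 0`.
    · obtain ⟨p, q, hz, hq⟩ := key (W.height (k + 1) (W.point 0 θ) • W.vertex 0 +
        (-W.height (k + 1) (W.vertex 0)) • W.point 0 θ) (by rw [height_add_smul]; ring)
      rw [height_add_smul] at hq
      have hq0 : 0 ≤ q := by
        refine nonneg_of_mul_nonneg_left ?_ hck
        rw [← hq]
        have := mul_nonneg hxk1 ihk.le
        have := mul_nonneg (neg_pos.2 ha).le hxk
        linarith
      have h2 := congrArg (fun z => W.σ * tripleProduct (W.vertex (k + 1)) z (W.vertex 0)) hz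
      simp only [point, tripleProduct_add_smul_middle, tripleProduct_self_right,
        tripleProduct_self_fst_snd, tripleProduct_reverse (W.vertex 0) (W.dir 0)] at h2
      have h4 : W.height (k + 1) (W.vertex 0) * (Real.sin θ * W.height 0 (W.vertex (k + 1)) - q)
          = 0 := by
        simp only [height] at h2 ⊢
        linear_combination h2
      rcases mul_eq_zero.1 h4 with h5 | h5
      · linarith
      · have := mul_neg_of_neg_of_pos hs hv0
        linarith
    · obtain ⟨p, q, hz, hq⟩ := key _ ha
      have hq0 : 0 < q := by
        refine pos_of_mul_pos_left ?_ hck.le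
        rw [← hq]; exact ihk
      have hb : W.height (k + 1) (W.dir 0) ≤ 0 := by
        rw [e0, ha] at hxk1
        by_contra! hb
        have := mul_neg_of_neg_of_pos hs hb
        linarith
      have h2 := congrArg (fun z => W.σ * tripleProduct (W.vertex (k + 1)) z (W.dir 0)) hz
      simp only [tripleProduct_add_smul_middle, tripleProduct_self_fst_snd] at h2
      rw [← tripleProduct_cyclic] at h2
      have h4 : W.height 0 (W.vertex (k + 1)) = q * W.height (k + 1) (W.dir 0) := by
        simp only [height]
        linear_combination h2
      have := mul_nonpos_of_nonneg_of_nonpos hq0.le hb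
      linarith

/-- `W'` runs through the closed curve of `n` edges `W` backwards, beginning with the same edge,
and its inner side is the same one. -/
structure IsReversal (W W' : TurningWalk) (n : ℕ) : Prop where
  length_zero : W'.length 0 = W.length 0
  length_eq : ∀ k, 1 ≤ k → k < n → W'.length k = W.length (n - k)
  point_zero : ∀ t, W'.point 0 t = W.point 0 (W.length 0 - t)
  point_eq : ∀ k, 1 ≤ k → k < n → ∀ t, W'.point k t = W.point (n - k) (W.length (n - k) - t)
  height_zero : ∀ y, W'.height 0 y = W.height 0 y

theorem IsReversal.height_one (hR : W.IsReversal W' n) (θ : ℝ) :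
    W'.height 1 (W.point 0 θ) = Real.sin θ * W'.height 0 (W'.dir 1) := by
  have := W'.height_succ_point 0 (W.length 0 - θ)
  rwa [hR.point_zero, hR.length_zero, sub_sub_cancel] at this

/-- The walk cannot meet the great circle of its initial edge before it closes up. -/
theorem SimpleClosed.false_of_hit (hW : W.SimpleClosed n) (hR : W.IsReversal W' n) {μ : ℕ}
    (hμ : μ + 1 < n)
    (hC : ∀ k < μ, ∀ t, 0 < t → t ≤ W.length (k + 1) → W.height 0 (W.point (k + 1) t) ≠ 0)
    {t₀ : ℝ} (h0 : 0 < t₀) (hL : t₀ ≤ W.length (μ + 1))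
    (hlt : ∀ t, 0 < t → t < t₀ → W.height 0 (W.point (μ + 1) t) ≠ 0)
    (hhit : W.height 0 (W.point (μ + 1) t₀) = 0)
    (hend : ¬ (μ + 2 = n ∧ t₀ = W.length (μ + 1))) : False := by
  have hF := hW.confined (by omega) hC
  have hB : ∀ t, 0 < t → t < t₀ → W.point (μ + 1) t ∉
      {y | W.height 0 y = 0} ∪ {y | ∃ j < μ, y ∈ W.edge (j + 1)} := by
    rintro t ht0 ht (h | ⟨j, hj, h⟩)
    · exact hlt t ht0 ht h
    · exact hW.point_notMem_edge (by omega) (by omega) hμ ht0 (by linarith) h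
  have hcl := hF.mem_closed h0 hB
  have ht₀pi : t₀ ≤ Real.pi := by
    by_contra! hpi
    have := (hF.lt_pi (T := Real.pi) fun t h1 h2 => hB t h1 (by linarith))
    exact lt_irrefl _ this
  have hge : ∀ i ≤ μ + 1, 0 ≤ W.height i (W.point (μ + 1) t₀) := by
    intro i hi
    rcases Nat.lt_or_ge i μ with h | h
    · exact hcl.1 i h
    · obtain rfl | rfl : i = μ ∨ i = μ + 1 := by omega
      · exact hcl.2
      · rw [W.height_point_self]
  obtain ⟨q, hq, t', ht', hxq, hlex⟩ := hW.exists_eq_point hμ ⟨h0.le, hL⟩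
  -- `(q, t')` is the parameter of the hit on half-open edges; `hend` excludes that it wraps around
  -- to the initial vertex.
  replace hlex : (q = μ + 1 ∧ t' = t₀) ∨ (q = μ + 2 ∧ t' = 0) := by
    rcases hlex with h | ⟨h1, h2, h3⟩
    · exact Or.inl ⟨h.1, h.2.1⟩
    · exact Or.inr ⟨by rcases h3 with h3 | h3; exacts [h3, absurd ⟨h3.2, h2⟩ hend], h1⟩
  have hqμ : μ + 1 ≤ q := by omega
  obtain ⟨θ, hθ0, hθ2, hxθ⟩ := W.exists_point_of_height_eq_zero hhit (W.norm_point _ _)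
  have hθ : W.length 0 < θ := by
    by_contra! hle
    obtain ⟨r, hr, s, hs, e, hc⟩ := hW.exists_eq_point (by omega) ⟨hθ0, hle⟩
    obtain ⟨h1, h2⟩ := hW.simple r hr q hq s hs t' ht' (by rw [← e, ← hxθ, hxq])
    rcases hc with ⟨rfl, -⟩ | ⟨rfl, -, rfl | ⟨rfl, h3⟩⟩
    · omega
    · rcases hlex with h | h
      · linarith [h.2]
      · omega
    · omega
  have hv : ∀ i, 2 ≤ i → i ≤ μ + 1 → 0 < W.height 0 (W.vertex i) := by
    intro i hi hiμ
    obtain ⟨j, rfl⟩ := Nat.exists_eq_add_of_le' hi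
    exact (hW.confined (m := j + 1) (by omega) fun k hk => hC k (by omega)).vertex_mem 0
      (by omega)
  obtain ⟨hsin, hLpi, hv0⟩ := W.height_vertex_zero_pos (m := μ + 1) (by omega) hθ hθ2
    (fun i _ hi => by rw [← hxθ]; exact hge i hi) hv
  -- the reversed walk is confined by the part of the curve up to the point of return
  have hb : W'.Confined 0 {y | ∀ i ∈ Finset.Icc 1 (μ + 1), 0 ≤ W.height i y}
      {y | ∀ i ∈ Finset.Icc 1 (μ + 1), 0 < W.height i y}
      {y | ∃ j < n, ∃ s ∈ Ico 0 (W.length j), y = W.point j s ∧ (j < q ∨ (j = q ∧ s ≤ t'))} := by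
    have hvert : W'.vertex 1 = W.vertex 0 := by
      rw [← W'.point_length 0, hR.point_zero, hR.length_zero, sub_self, W.point_zero]
    refine ⟨?_, ?_, ?_, ?_, ?_, ?_, ?_⟩
    · have : {y | ∀ i ∈ Finset.Icc 1 (μ + 1), 0 ≤ W.height i y}
          = ⋂ i ∈ Finset.Icc 1 (μ + 1), {y | 0 ≤ W.height i y} := by ext; simp
      rw [this]
      exact isClosed_biInter fun i _ => isClosed_le continuous_const (W.continuous_height i)
    · have : {y | ∀ i ∈ Finset.Icc 1 (μ + 1), 0 < W.height i y}
          = ⋂ i ∈ Finset.Icc 1 (μ + 1), {y | 0 < W.height i y} := by ext; simp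
      rw [this]
      exact isOpen_biInter_finset fun i _ => isOpen_lt continuous_const (W.continuous_height i)
    · exact fun y hy i hi => (hy i hi).le
    · rw [hvert]
      exact fun i hi => hv0 i (Finset.mem_Icc.1 hi).1 (Finset.mem_Icc.1 hi).2
    · intro y hy hN hU hpos
      rw [hR.height_zero] at hpos
      have hyge : ∀ i ≤ μ + 1, 0 ≤ W.height i y := by
        intro i hi
        rcases Nat.eq_zero_or_pos i with rfl | hi0
        · exact hpos.le
        · exact hN i (Finset.mem_Icc.2 ⟨hi0, hi⟩)
      rcases (hyge (μ + 1) le_rfl).eq_or_lt with hline | hline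
      · obtain ⟨t, ht0, ht2, rfl⟩ := W.exists_point_of_height_eq_zero hline.symm hy
        have hs := hyge μ (by omega)
        rw [W.height_point_succ] at hs
        replace hs := nonneg_of_mul_nonneg_left hs (W.height_dir_succ_pos μ)
        have htpi : t ≤ Real.pi := by
          by_contra! hpi
          have := Real.sin_pos_of_pos_of_lt_pi (x := t - Real.pi) (by linarith) (by linarith)
          rw [Real.sin_sub_pi] at this
          linarith
        have ha : 0 ≤ W.height 0 (W.vertex (μ + 1)) := by
          rcases Nat.eq_zero_or_pos μ with rfl | hμ0
          · rw [W.height_vertex_succ]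
          · exact (hv (μ + 1) (by omega) le_rfl).le
        -- Between `t₀` and `π` the great circle of edge `μ + 1` is on or below that of the initial
        -- edge, against `hpos`.
        have htt : t < t₀ := by
          by_contra! hge
          rcases hge.eq_or_lt with rfl | hgt
          · linarith
          have hs0 : 0 < Real.sin t₀ := Real.sin_pos_of_pos_of_lt_pi h0 (by linarith)
          have hs1 : 0 ≤ Real.sin (t - t₀) :=
            Real.sin_nonneg_of_nonneg_of_le_pi (by linarith) (by linarith)
          rw [Real.sin_sub] at hs1
          rw [W.height_point] at hpos hhit
          have h1 := mul_pos hs0 hpos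
          have h2 := mul_nonneg ha hs1
          have h3 : Real.sin t₀ * (Real.cos t * W.height 0 (W.vertex (μ + 1)) +
              Real.sin t * W.height 0 (W.dir (μ + 1)))
              = -(W.height 0 (W.vertex (μ + 1)) *
                (Real.sin t * Real.cos t₀ - Real.cos t * Real.sin t₀)) := by
            linear_combination Real.sin t * hhit
          linarith
        refine ⟨μ + 1, hμ, t, ⟨ht0, by linarith⟩, rfl, ?_⟩
        rcases hlex with h | h
        · exact Or.inr ⟨h.1.symm, by rw [h.2]; exact htt.le⟩
        · exact Or.inl (by omega)
      · have hmem : y ∈ {y | W.height 0 y = 0} ∪ {y | ∃ j < μ, y ∈ W.edge (j + 1)} := by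
          rcases (hyge μ (by omega)).eq_or_lt with hl | hl
          · exact hF.barrier_line y hy (fun i hi => hyge i (by omega)) hl.symm hline
          · refine hF.barrier y hy (fun i hi => hyge i (by omega)) (fun hU' => hU fun i hi => ?_) hl
            have hi' := Finset.mem_Icc.1 hi
            rcases Nat.lt_or_ge i μ with h | h
            · exact hU' i h
            · obtain rfl | rfl : i = μ ∨ i = μ + 1 := by omega
              · exact hl
              · exact hline
        rcases hmem with h | ⟨j, hj, s, hs, rfl⟩
        · exact absurd h hpos.ne'
        · obtain ⟨r, hr, s', hs', e, hc⟩ := hW.exists_eq_point (k := j + 1) (by omega) hs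
          refine ⟨r, hr, s', hs', e, ?_⟩
          rcases hc with ⟨rfl, -⟩ | ⟨rfl, -, rfl | ⟨-, h3⟩⟩
          · exact Or.inl (by omega)
          · rcases Nat.lt_or_ge (j + 1 + 1) q with h | h
            · exact Or.inl h
            · exact Or.inr ⟨by omega, ht'.1⟩
          · omega
    · intro y hy hN hline hpos
      rw [hR.height_zero] at hline
      obtain ⟨φ, hφ0, hφ2, rfl⟩ := W.exists_point_of_height_eq_zero hline hy
      rw [zero_add, hR.height_one] at hpos
      have hs := pos_of_mul_pos_left hpos (W'.height_dir_succ_pos 0).le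
      have h1 : 0 ≤ W.height (0 + 1) (W.point 0 φ) := hN 1 (Finset.mem_Icc.2 ⟨le_rfl, by omega⟩)
      rw [W.height_succ_point] at h1
      replace h1 := nonneg_of_mul_nonneg_left h1 (W.height_dir_succ_pos 0)
      -- Being inside both neighbours of the initial edge singles out this edge on its great circle.
      have hφpi : φ < Real.pi := by
        by_contra! hpi
        have := Real.sin_nonneg_of_nonneg_of_le_pi (x := φ - Real.pi) (by linarith) (by linarith)
        rw [Real.sin_sub_pi] at this
        linarith
      have hφL : φ ≤ W.length 0 := by
        by_contra! hgt
        have hL0 := W.length_pos 0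
        have := Real.sin_pos_of_pos_of_lt_pi (x := φ - W.length 0) (by linarith) (by linarith)
        rw [← neg_sub, Real.sin_neg] at this
        linarith
      obtain ⟨r, hr, s', hs', e, hc⟩ := hW.exists_eq_point (k := 0) (by omega) ⟨hφ0, hφL⟩
      refine ⟨r, hr, s', hs', e, ?_⟩
      rcases hc with ⟨rfl, -⟩ | ⟨rfl, -, rfl | ⟨-, h3⟩⟩
      · exact Or.inl (by omega)
      · rcases Nat.lt_or_ge (0 + 1) q with h | h
        · exact Or.inl h
        · exact Or.inr ⟨by omega, ht'.1⟩
      · omega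
    · intro hN
      have h1 : 0 ≤ W.height 1 (-W'.vertex (0 + 1)) := hN 1 (Finset.mem_Icc.2 ⟨le_rfl, by omega⟩)
      rw [zero_add, hvert, W.height_neg] at h1
      have := hv0 1 le_rfl (by omega)
      linarith
  -- it therefore runs back to the point of return, which is on the wrong side
  have havoid : ∀ k, k + 1 ≤ n - q → ∀ t, 0 < t → t ≤ W'.length (k + 1) →
      (k + 1 = n - q → t < W.length q - t') →
      W'.point (k + 1) t ∉ {y | ∃ j < n, ∃ s ∈ Ico 0 (W.length j), y = W.point j s ∧
        (j < q ∨ (j = q ∧ s ≤ t'))} ∧ ∀ j < k, W'.point (k + 1) t ∉ W'.edge (j + 1) := by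
    intro k hk t ht0 ht hlast
    have hmem : W.length (n - (k + 1)) - t ∈ Ico 0 (W.length (n - (k + 1))) := by
      rw [hR.length_eq (k + 1) (by omega) (by omega)] at ht
      exact ⟨by linarith, by linarith⟩
    rw [hR.point_eq (k + 1) (by omega) (by omega)]
    refine ⟨?_, ?_⟩
    · rintro ⟨j, hj, s, hs, e, hc⟩
      obtain ⟨h1, h2⟩ := hW.simple _ (by omega) j hj _ hmem s hs e
      rcases hc with hc | ⟨rfl, hc⟩
      · omega
      · have := hlast (by omega)
        rw [h1] at h2
        linarith
    · rintro j hj ⟨s, hs, e⟩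
      rw [hR.point_eq (j + 1) (by omega) (by omega)] at e
      rw [hR.length_eq (j + 1) (by omega) (by omega)] at hs
      obtain ⟨r, hr, s', hs', e', hc⟩ := hW.exists_eq_point (k := n - (j + 1)) (by omega)
        (t := W.length (n - (j + 1)) - s) ⟨by linarith [hs.2], by linarith [hs.1]⟩
      obtain ⟨h1, h2⟩ := hW.simple _ (by omega) r hr _ hmem s' hs' (by rw [← e, e'])
      rcases hc with ⟨rfl, -⟩ | ⟨rfl, -, rfl | ⟨rfl, h3⟩⟩ <;> omega
  obtain ⟨k, hk⟩ : ∃ k, n - q = k + 1 := ⟨n - q - 1, by omega⟩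
  have hlenq : W'.length (k + 1) = W.length q := by
    rw [hR.length_eq _ (by omega) (by omega)]; congr 1; omega
  have hfin := hb.iterate k fun j hj t ht0 ht =>
    havoid j (by omega) t ht0 ht (fun h => absurd h (by omega))
  have hend' := hfin.mem_closed (T := W.length q - t') (by linarith [ht'.2]) (by
    rintro s hs0 hs (h | ⟨j, hj, h⟩)
    · exact (havoid k (by omega) s hs0 (by rw [hlenq]; linarith [ht'.1]) fun _ => hs).1 h
    · exact (havoid k (by omega) s hs0 (by rw [hlenq]; linarith [ht'.1]) fun _ => hs).2 j hj h)
  have hx : W'.point (k + 1) (W.length q - t') = W.point 0 θ := by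
    have hnk : n - (k + 1) = q := by omega
    rw [hR.point_eq _ (by omega) (by omega), hnk, sub_sub_cancel, ← hxq, hxθ]
  rw [hx] at hend'
  have hneg : W'.height 1 (W.point 0 θ) < 0 := by
    rw [hR.height_one]
    exact mul_neg_of_neg_of_pos hsin (W'.height_dir_succ_pos 0)
  -- Inner side of edge 1 of the reversed walk: an accumulated constraint if `k > 1`, the latest one
  -- if `k = 1`, and for `k = 0` the point lies on that edge itself.
  rcases Nat.lt_or_ge 1 k with h | h
  · exact absurd (hend'.1.2 1 h) (not_le.2 hneg)
  · obtain rfl | rfl : k = 0 ∨ k = 1 := by omega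
    · rw [← hx, zero_add, W'.height_point_self] at hneg
      exact lt_irrefl _ hneg
    · exact absurd hend'.2 (not_le.2 hneg)

theorem SimpleClosed.height_zero_ne_zero (hW : W.SimpleClosed n) (hR : W.IsReversal W' n) (μ : ℕ)
    (hμ : μ + 1 < n) (t : ℝ) (h0 : 0 < t) (hL : t ≤ W.length (μ + 1))
    (hend : ¬ (μ + 2 = n ∧ t = W.length (μ + 1))) : W.height 0 (W.point (μ + 1) t) ≠ 0 := by
  induction μ using Nat.strong_induction_on generalizing t with
  | _ μ ih =>
    intro hhit
    have hC : ∀ k < μ, ∀ t, 0 < t → t ≤ W.length (k + 1) →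
        W.height 0 (W.point (k + 1) t) ≠ 0 :=
      fun k hk t ht0 ht => ih k hk (by omega) t ht0 ht (by omega)
    -- Edge 1 starts on the great circle, so the least zero over a closed interval would be the
    -- trivial one; its only other zero is at `π`.
    rcases Nat.eq_zero_or_pos μ with rfl | hpos
    · refine hW.false_of_hit hR hμ hC h0 hL (fun s hs0 hs hs' => ?_) hhit hend
      have hc := W.height_dir_succ_pos 0
      rw [W.height_point_succ] at hhit hs'
      replace hhit := (mul_eq_zero.1 hhit).resolve_right hc.ne'
      replace hs' := (mul_eq_zero.1 hs').resolve_right hc.ne'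
      have hspi : Real.pi ≤ s := by
        by_contra! h
        exact (Real.sin_pos_of_pos_of_lt_pi hs0 h).ne' hs'
      have := Real.sin_pos_of_pos_of_lt_pi (x := t - Real.pi) (by linarith)
        (by linarith [W.length_lt (0 + 1)])
      rw [Real.sin_sub_pi, hhit, neg_zero] at this
      exact lt_irrefl _ this
    · have hcomp : IsCompact (Icc 0 t ∩ {s | W.height 0 (W.point (μ + 1) s) = 0}) :=
        isCompact_Icc.inter_right (isClosed_eq (by fun_prop) continuous_const)
      obtain ⟨t₀, ⟨⟨ht0, htt⟩, hz⟩, hmin⟩ := hcomp.exists_isLeast ⟨t, ⟨h0.le, le_rfl⟩, hhit⟩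
      have hz' : W.height 0 (W.point (μ + 1) t₀) = 0 := hz
      have hpos' : 0 < t₀ := by
        rcases ht0.eq_or_lt with rfl | h
        · have : 0 < W.height 0 (W.vertex (μ + 1)) :=
            (hW.confined (by omega) hC).vertex_mem 0 hpos
          rw [W.point_zero] at hz'
          linarith
        · exact h
      refine hW.false_of_hit hR hμ hC hpos' (htt.trans hL) (fun s hs0 hs hs' => ?_) hz'
        (fun h => hend ⟨h.1, by linarith [h.2]⟩)
      exact absurd (hmin ⟨⟨hs0.le, by linarith⟩, hs'⟩) (not_le.2 hs)

/-- A simple closed walk is on the inner side of its initial edge. -/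
theorem SimpleClosed.height_zero_pos (hW : W.SimpleClosed n) (hR : W.IsReversal W' n) {μ : ℕ}
    (hμ : μ + 1 < n) {t : ℝ} (h0 : 0 < t) (hL : t ≤ W.length (μ + 1))
    (hend : ¬ (μ + 2 = n ∧ t = W.length (μ + 1))) : 0 < W.height 0 (W.point (μ + 1) t) := by
  have hF := hW.confined (m := μ) (by omega) fun k hk s hs0 hs =>
    hW.height_zero_ne_zero hR k (by omega) s hs0 hs (by omega)
  have := hF.mem h0 (by
    rintro s hs0 hs (h | ⟨j, hj, h⟩)
    · exact hW.height_zero_ne_zero hR μ hμ s hs0 (hs.trans hL)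
        (fun h => hend ⟨h.1, by linarith [h.2]⟩) h
    · exact hW.point_notMem_edge (by omega) (by omega) hμ hs0 (hs.trans hL) h)
  rcases Nat.eq_zero_or_pos μ with rfl | hpos
  · exact this.2
  · exact this.1 0 hpos

theorem SimpleClosed.height_zero_pos_of_notMem_edge (hW : W.SimpleClosed n)
    (hR : W.IsReversal W' n) {k : ℕ} (hk : k < n) {t : ℝ} (ht : t ∈ Icc 0 (W.length k))
    (hnot : W.point k t ∉ W.edge 0) : 0 < W.height 0 (W.point k t) := by
  have h0mem : W.vertex 0 ∈ W.edge 0 := ⟨0, ⟨le_rfl, (W.length_pos 0).le⟩, W.point_zero 0⟩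
  have h1mem : W.vertex 1 ∈ W.edge 0 :=
    ⟨W.length 0, ⟨(W.length_pos 0).le, le_rfl⟩, W.point_length 0⟩
  rcases k with _ | μ
  · exact absurd ⟨t, ht, rfl⟩ hnot
  rcases ht.1.eq_or_lt with rfl | h0
  · rw [W.point_zero] at hnot ⊢
    rcases μ with _ | ν
    · exact absurd h1mem hnot
    · rw [← W.point_length]
      exact hW.height_zero_pos hR (by omega) (W.length_pos _) le_rfl (by omega)
  · refine hW.height_zero_pos hR hk h0 ht.2 fun h => ?_
    rw [h.2, W.point_length, h.1, hW.closed] at hnot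
    exact hnot h0mem

end TurningWalk

end SphPoly

/-! ### From polygons with cyclic indices to walks. -/

namespace SphPoly

theorem nsmul_one_fin {n : ℕ} [NeZero n] (m : ℕ) : m • (1 : Fin n) = Fin.ofNat n m := by
  induction m with
  | zero => simp
  | succ m ih => rw [succ_nsmul, ih]; ext; simp [Fin.val_add]

theorem nsmul_one_fin_injOn {n : ℕ} [NeZero n] {k l : ℕ} (hk : k < n) (hl : l < n)
    (h : k • (1 : Fin n) = l • (1 : Fin n)) : k = l := by
  rw [nsmul_one_fin, nsmul_one_fin, Fin.ext_iff] at h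
  simpa [Nat.mod_eq_of_lt hk, Nat.mod_eq_of_lt hl] using h

theorem exists_eq_add_nsmul_one {n : ℕ} [NeZero n] (i j : Fin n) :
    ∃ k < n, j = i + k • (1 : Fin n) := by
  refine ⟨(j - i).val, (j - i).isLt, ?_⟩
  rw [nsmul_one_fin, Fin.ofNat_val_eq_self]
  abel

theorem nsmul_one_fin_self {n : ℕ} [NeZero n] : n • (1 : Fin n) = 0 := by
  simpa using card_nsmul_eq_zero (x := (1 : Fin n))

theorem sub_nsmul_one {n : ℕ} [NeZero n] (i : Fin n) {k : ℕ} (hk : k ≤ n) :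
    i - k • (1 : Fin n) = i + (n - k) • (1 : Fin n) := by
  have h : (n - k) • (1 : Fin n) + k • (1 : Fin n) = 0 := by
    rw [← add_nsmul, Nat.sub_add_cancel hk, nsmul_one_fin_self]
  rw [eq_neg_of_add_eq_zero_left h]
  abel

namespace SphericalPolygon

open Set

variable {n : ℕ} [NeZero n] (P : SphericalPolygon n)

theorem point_length (i : Fin n) : P.point i (P.length i) = P.vertex (i + 1) := P.end_eq i

theorem point_zero (i : Fin n) : P.point i 0 = P.vertex i := by simp [point]

theorem inner_point_velocity (i : Fin n) (t : ℝ) :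
    ‖P.velocity i t‖ = 1 ∧ ‖P.point i t‖ = 1 ∧ inner ℝ (P.point i t) (P.velocity i t) = 0 := by
  have h1 := P.inner_vertex_dir i
  have h2 : inner ℝ (P.dir i) (P.vertex i) = (0 : ℝ) := by rw [real_inner_comm]; exact h1
  have h := Real.sin_sq_add_cos_sq t
  refine ⟨?_, ?_, ?_⟩
  · rw [← pow_eq_one_iff_of_nonneg (norm_nonneg _) two_ne_zero, ← real_inner_self_eq_norm_sq,
      velocity]
    simp only [inner_add_left, inner_add_right, inner_smul_left, inner_smul_right,
      real_inner_self_eq_norm_sq, P.norm_vertex, P.norm_dir, h1, h2, RCLike.conj_to_real]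
    linear_combination h
  · rw [← pow_eq_one_iff_of_nonneg (norm_nonneg _) two_ne_zero, ← real_inner_self_eq_norm_sq,
      point]
    simp only [inner_add_left, inner_add_right, inner_smul_left, inner_smul_right,
      real_inner_self_eq_norm_sq, P.norm_vertex, P.norm_dir, h1, h2, RCLike.conj_to_real]
    linear_combination h
  · rw [point, velocity]
    simp only [inner_add_left, inner_add_right, inner_smul_left, inner_smul_right,
      real_inner_self_eq_norm_sq, P.norm_vertex, P.norm_dir, h1, h2, RCLike.conj_to_real]
    ring

theorem backDir_succ (i : Fin n) : P.backDir (i + 1) = -P.velocity i (P.length i) := by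
  rw [backDir, add_sub_cancel_right]

theorem norm_backDir (i : Fin n) : ‖P.backDir i‖ = 1 := by
  rw [backDir, norm_neg]; exact (P.inner_point_velocity _ _).1

theorem inner_vertex_backDir (i : Fin n) : inner ℝ (P.vertex i) (P.backDir i) = 0 := by
  have := (P.inner_point_velocity (i - 1) (P.length (i - 1))).2.2
  rw [point_length, sub_add_cancel] at this
  rw [backDir, inner_neg_right, this, neg_zero]

/-- Running through an edge backwards. -/
theorem point_reverse (i : Fin n) (t : ℝ) :
    Real.cos t • P.vertex (i + 1) + Real.sin t • P.backDir (i + 1)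
      = P.point i (P.length i - t) := by
  rw [backDir_succ, ← P.end_eq, velocity, point, Real.cos_sub, Real.sin_sub]
  module

theorem tripleProduct_vertex_succ (i : Fin n) (b : E3) :
    tripleProduct (P.vertex (i + 1)) (P.backDir (i + 1)) b
      = -tripleProduct (P.vertex i) (P.dir i) b := by
  rw [← tripleProduct_rotate (P.vertex i) _ _ (P.length i), P.end_eq, backDir_succ, velocity]
  simp only [tripleProduct_eq, PiLp.neg_apply]
  ring

/-- The walk along the polygon that starts with the `i`-th edge. -/
noncomputable def walk {σ : ℝ}
    (hσ : ∀ i, 0 < σ * tripleProduct (P.vertex i) (P.dir i) (P.backDir i)) (i : Fin n) :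
    TurningWalk where
  vertex k := P.vertex (i + k • 1)
  dir k := P.dir (i + k • 1)
  length k := P.length (i + k • 1)
  σ := σ
  norm_vertex _ := P.norm_vertex _
  norm_dir _ := P.norm_dir _
  inner_vertex_dir _ := P.inner_vertex_dir _
  length_pos _ := P.length_pos _
  length_lt _ := P.length_lt _
  end_eq k := by rw [P.end_eq, succ_nsmul, add_assoc]
  turn k := by
    have h := hσ (i + k • 1 + 1)
    rw [tripleProduct_swap, tripleProduct_vertex_succ, neg_neg] at h
    rwa [succ_nsmul, ← add_assoc]

/-- The walk along the polygon in the opposite direction that starts with the `i`-th edge. -/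
noncomputable def reverseWalk {σ : ℝ}
    (hσ : ∀ i, 0 < σ * tripleProduct (P.vertex i) (P.dir i) (P.backDir i)) (i : Fin n) :
    TurningWalk where
  vertex k := P.vertex (i - k • 1 + 1)
  dir k := P.backDir (i - k • 1 + 1)
  length k := P.length (i - k • 1)
  σ := -σ
  norm_vertex _ := P.norm_vertex _
  norm_dir _ := P.norm_backDir _
  inner_vertex_dir _ := P.inner_vertex_backDir _
  length_pos _ := P.length_pos _
  length_lt _ := P.length_lt _
  end_eq k := by
    rw [P.point_reverse, sub_self, P.point_zero, succ_nsmul, sub_add_eq_sub_sub, sub_add_cancel]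
  turn k := by
    rw [tripleProduct_vertex_succ, succ_nsmul, sub_add_eq_sub_sub, sub_add_cancel, neg_mul_neg]
    exact hσ _

theorem simpleClosed_walk (hP : P.IsSimple) {σ : ℝ}
    (hσ : ∀ i, 0 < σ * tripleProduct (P.vertex i) (P.dir i) (P.backDir i)) (i : Fin n) :
    (P.walk hσ i).SimpleClosed n where
  simple k hk l hl s hs t ht h := by
    obtain ⟨h1, h2⟩ := hP (i + k • 1) (i + l • 1) s hs t ht h
    exact ⟨nsmul_one_fin_injOn hk hl (add_left_cancel h1), h2⟩
  closed := by
    simp only [walk, zero_nsmul, add_zero, nsmul_one_fin_self]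

theorem isReversal_reverseWalk {σ : ℝ}
    (hσ : ∀ i, 0 < σ * tripleProduct (P.vertex i) (P.dir i) (P.backDir i)) (i : Fin n) :
    (P.walk hσ i).IsReversal (P.reverseWalk hσ i) n where
  length_zero := by simp [walk, reverseWalk]
  length_eq k _ hk := by simp only [walk, reverseWalk]; rw [sub_nsmul_one i hk.le]
  point_zero t := by
    simp only [walk, reverseWalk, TurningWalk.point]
    rw [P.point_reverse]
    simp [point]
  point_eq k _ hk t := by
    simp only [walk, reverseWalk, TurningWalk.point]
    rw [P.point_reverse, sub_nsmul_one i hk.le]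
    rfl
  height_zero y := by
    simp only [walk, reverseWalk, TurningWalk.height, P.tripleProduct_vertex_succ]
    simp

/-- Otherwise the two edges at the vertex would overlap near it. This excludes the angle 0. -/
theorem isSimple_dir_ne_backDir (hn : 2 ≤ n) (hP : P.IsSimple) (i : Fin n) :
    P.dir i ≠ P.backDir i := by
  intro h
  obtain ⟨t, h0, ht⟩ := exists_between (lt_min (P.length_pos i) (P.length_pos (i - 1)))
  rw [lt_min_iff] at ht
  have e := P.point_reverse (i - 1) t
  rw [sub_add_cancel, ← h] at e
  obtain ⟨h1, -⟩ := hP i (i - 1) t ⟨h0.le, ht.1⟩ (P.length (i - 1) - t)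
    ⟨by linarith [ht.2], by linarith⟩ e
  have h2 : (1 : ℕ) • (1 : Fin n) = (0 : ℕ) • (1 : Fin n) := by
    rw [one_nsmul, zero_nsmul]; exact sub_eq_self.1 h1.symm
  exact one_ne_zero (nsmul_one_fin_injOn (by omega) (by omega) h2)

/-- The interior angles of a simple polygon being less than `π`, it turns to its interior side
at every vertex. -/
theorem exists_orientation (hn : 2 ≤ n) (hP : P.IsSimple) (side : Side)
    (hangle : ∀ i, P.interiorAngle side i < Real.pi) :
    ∃ σ : ℝ, ∀ i, 0 < σ * tripleProduct (P.vertex i) (P.dir i) (P.backDir i) := by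
  cases side with
  | left =>
    refine ⟨1, fun i => ?_⟩
    have h := hangle i
    set z : ℂ := ⟨inner ℝ (P.dir i) (P.backDir i),
      tripleProduct (P.vertex i) (P.dir i) (P.backDir i)⟩
    change (if 0 ≤ z.arg then z.arg else z.arg + 2 * Real.pi) < Real.pi at h
    have harg : 0 ≤ z.arg := by
      by_contra hneg
      rw [if_neg hneg] at h
      linarith [Complex.neg_pi_lt_arg z]
    rw [if_pos harg] at h
    rw [one_mul]
    refine lt_of_le_of_ne (Complex.arg_nonneg_iff.1 harg) fun h0 => ?_
    have hsq := sq_tripleProduct (P.norm_vertex i) (P.norm_dir i) (P.inner_vertex_dir i)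
      (P.backDir i)
    rw [← h0, P.inner_vertex_backDir, real_inner_self_eq_norm_sq, P.norm_backDir] at hsq
    have hre : z.re = 1 ∨ z.re = -1 := by
      refine sq_eq_one_iff.1 ?_
      change (inner ℝ (P.dir i) (P.backDir i) : ℝ) ^ 2 = 1
      linarith
    rcases hre with hre | hre
    · exact P.isSimple_dir_ne_backDir hn hP i
        ((inner_eq_one_iff_of_norm_eq_one (P.norm_dir i) (P.norm_backDir i)).1 hre)
    · have : z.arg = Real.pi := Complex.arg_eq_pi_iff.2 ⟨by rw [hre]; norm_num, h0.symm⟩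
      linarith
  | right =>
    refine ⟨-1, fun i => ?_⟩
    have h := hangle i
    set z : ℂ := ⟨inner ℝ (P.dir i) (P.backDir i),
      tripleProduct (P.vertex i) (P.dir i) (P.backDir i)⟩
    change 2 * Real.pi - (if 0 ≤ z.arg then z.arg else z.arg + 2 * Real.pi) < Real.pi at h
    -- Here the strict inequality also excludes the degenerate cases, so simplicity is not needed.
    have harg : z.arg < 0 := by
      by_contra! hneg
      rw [if_pos hneg] at h
      linarith [Complex.arg_le_pi z]
    have : tripleProduct (P.vertex i) (P.dir i) (P.backDir i) < 0 := Complex.arg_neg_iff.1 harg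
    linarith

/-! ### Poles of the edges and supporting hemispheres. -/

/-- The pole of the great circle of an edge, on the positive side. -/
noncomputable def pole (σ : ℝ) (i : Fin n) : E3 :=
  !₂[σ * (P.vertex i 1 * P.dir i 2 - P.vertex i 2 * P.dir i 1),
    σ * (P.vertex i 2 * P.dir i 0 - P.vertex i 0 * P.dir i 2),
    σ * (P.vertex i 0 * P.dir i 1 - P.vertex i 1 * P.dir i 0)]

theorem inner_pole (σ : ℝ) (i : Fin n) (y : E3) :
    inner ℝ (P.pole σ i) y = σ * tripleProduct (P.vertex i) (P.dir i) y := by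
  simp [pole, inner_eq, tripleProduct_eq]; ring

theorem inner_pole_point (σ : ℝ) (i : Fin n) (t : ℝ) :
    inner ℝ (P.pole σ i) (P.point i t) = 0 := by
  rw [inner_pole, point, tripleProduct_add_smul, tripleProduct_self_left, tripleProduct_self_right]
  ring

variable {P}

/-- The rest of a simple polygon with angles less than `π` is on the inner side of each edge. -/
theorem inner_pole_pos (hP : P.IsSimple) {σ : ℝ}
    (hσ : ∀ i, 0 < σ * tripleProduct (P.vertex i) (P.dir i) (P.backDir i)) (i : Fin n) {y : E3}
    (hy : y ∈ P.carrier) (hyi : y ∉ P.edge i) : 0 < inner ℝ (P.pole σ i) y := by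
  obtain ⟨j, t, ht, rfl⟩ := mem_iUnion.1 hy
  obtain ⟨k, hk, rfl⟩ := exists_eq_add_nsmul_one i j
  have hW := P.simpleClosed_walk hP hσ i
  have he : ∀ s, P.point i s = (P.walk hσ i).point 0 s := by
    intro s; simp [walk, TurningWalk.point, point]
  have hedge : P.edge i = (P.walk hσ i).edge 0 := by
    simp only [edge, TurningWalk.edge]
    rw [funext he]
    simp [walk]
  have hpole : ∀ z, inner ℝ (P.pole σ i) z = (P.walk hσ i).height 0 z := by
    intro z; rw [inner_pole]; simp [walk, TurningWalk.height]
  rw [hpole]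
  rw [hedge] at hyi
  exact hW.height_zero_pos_of_notMem_edge (P.isReversal_reverseWalk hσ i) hk ht hyi

theorem inner_pole_nonneg (hP : P.IsSimple) {σ : ℝ}
    (hσ : ∀ i, 0 < σ * tripleProduct (P.vertex i) (P.dir i) (P.backDir i)) (i : Fin n) {y : E3}
    (hy : y ∈ P.carrier) : 0 ≤ inner ℝ (P.pole σ i) y := by
  by_cases hyi : y ∈ P.edge i
  · obtain ⟨t, -, rfl⟩ := hyi
    rw [inner_pole_point]
  · exact (inner_pole_pos hP hσ i hy hyi).le

theorem norm_eq_one_of_mem_carrier {y : E3} (hy : y ∈ P.carrier) : ‖y‖ = 1 := by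
  obtain ⟨j, t, ht, rfl⟩ := mem_iUnion.1 hy
  exact (P.inner_point_velocity j t).2.1

/-- A simple polygon with at least three edges has no point that is common to all edges. -/
theorem IsSimple.exists_notMem_edge (hn : 3 ≤ n) (hP : P.IsSimple) (y : E3) :
    ∃ i, y ∉ P.edge i := by
  by_contra! hall
  have key : ∀ i, ∃ q, (q = i ∨ q = i + 1) ∧ ∃ s ∈ Ico 0 (P.length q), y = P.point q s := by
    intro i
    obtain ⟨t, ht, rfl⟩ := hall i
    rcases ht.2.lt_or_eq with h | rfl
    · exact ⟨i, Or.inl rfl, t, ⟨ht.1, h⟩, rfl⟩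
    · exact ⟨i + 1, Or.inr rfl, 0, ⟨le_rfl, P.length_pos _⟩, by rw [point_length, point_zero]⟩
  obtain ⟨q, -, s, hs, hqs⟩ := key 0
  obtain ⟨r, hr, s', hs', hrs⟩ := key (q + 1)
  obtain ⟨rfl, -⟩ := hP q r s hs s' hs' (by rw [← hqs, hrs])
  -- A point on half-open edge `q` that is also on the closed edge `q + 1` forces `q` to equal `q +
  -- 1` or `q + 2`, which is impossible modulo `n ≥ 3`.
  have h0 : (0 : Fin n) = (0 : ℕ) • 1 := (zero_nsmul _).symm
  rcases hr with hr | hr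
  · have h1 : (1 : ℕ) • (1 : Fin n) = (0 : ℕ) • 1 := by
      rw [one_nsmul, ← h0]; exact left_eq_add.1 hr
    exact absurd (nsmul_one_fin_injOn (by omega) (by omega) h1) (by omega)
  · have h2 : (2 : ℕ) • (1 : Fin n) = (0 : ℕ) • 1 := by
      rw [two_nsmul, ← h0]; exact left_eq_add.1 (by rwa [add_assoc] at hr)
    exact absurd (nsmul_one_fin_injOn (by omega) (by omega) h2) (by omega)

/-- The rest of the polygon is in the interior of every hemisphere that contains the polygon and
has the edge on its boundary. -/
theorem diff_edge_subset_openHemisphere (hP : P.IsSimple) {σ : ℝ}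
    (hσ : ∀ i, 0 < σ * tripleProduct (P.vertex i) (P.dir i) (P.backDir i)) (i : Fin n) {w : E3}
    (hw : ‖w‖ = 1) (hcar : P.carrier ⊆ closedHemisphere w) (hedge : P.edge i ⊆ greatCircle w) :
    P.carrier \ P.edge i ⊆ openHemisphere w := by
  rintro y ⟨hy, hyi⟩
  have hpos := inner_pole_pos hP hσ i hy hyi
  rw [inner_pole] at hpos
  have hL := P.length_pos i
  have hwv : inner ℝ w (P.vertex i) = (0 : ℝ) := by
    have := (hedge ⟨0, ⟨le_rfl, hL.le⟩, rfl⟩).2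
    rwa [point_zero] at this
  have hwd : inner ℝ w (P.dir i) = (0 : ℝ) := by
    -- The midpoint works because half the length is in `(0, π)`, where the sine is not zero.
    have := (hedge ⟨P.length i / 2, ⟨by linarith, by linarith⟩, rfl⟩).2
    rw [point, inner_add_right, inner_smul_right, inner_smul_right, hwv, mul_zero, zero_add] at this
    refine (mul_eq_zero.1 this).resolve_left (Real.sin_pos_of_pos_of_lt_pi (by linarith) ?_).ne'
    linarith [P.length_lt i]
  have hgram := tripleProduct_mul_of_orthogonal (P.norm_vertex i) (P.norm_dir i)
    (P.inner_vertex_dir i) hwv hwd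
  refine ⟨norm_eq_one_of_mem_carrier hy, lt_of_le_of_ne (hcar hy).2 fun h0 => ?_⟩
  have hww := hgram w
  rw [real_inner_self_eq_norm_sq, hw] at hww
  have hwy := hgram y
  rw [← h0] at hwy
  rcases mul_eq_zero.1 hwy with h | h
  · rw [h] at hww; norm_num at hww
  · rw [h, mul_zero] at hpos; exact lt_irrefl _ hpos

end SphericalPolygon

theorem exists_unit_smul {v : E3} (hv : v ≠ 0) :
    ∃ w : E3, ‖w‖ = 1 ∧ ∃ c > 0, ∀ y : E3, inner ℝ w y = c * inner ℝ v y :=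
  ⟨‖v‖⁻¹ • v, norm_smul_inv_norm hv, ‖v‖⁻¹, inv_pos.2 (norm_pos_iff.2 hv),
    fun _ => real_inner_smul_left _ _ _⟩

end SphPoly

theorem mainTheorem7 {n : ℕ} [NeZero n] (hn : 2 ≤ n)
    (P : SphPoly.SphericalPolygon n) (side : SphPoly.Side)
    (hsimple : P.IsSimple)
    (hangle : ∀ i, P.interiorAngle side i < Real.pi) :
    (∃ w : SphPoly.E3, ‖w‖ = 1 ∧ P.carrier ⊆ SphPoly.closedHemisphere w) ∧
    (∀ i,
      (∃ w : SphPoly.E3, ‖w‖ = 1 ∧ P.edge i ⊆ SphPoly.greatCircle w ∧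
        P.carrier ⊆ SphPoly.closedHemisphere w) ∧
      (∀ w : SphPoly.E3, ‖w‖ = 1 → P.carrier ⊆ SphPoly.closedHemisphere w →
        P.edge i ⊆ SphPoly.greatCircle w →
        P.carrier \ P.edge i ⊆ SphPoly.openHemisphere w)) ∧
    (P.IsBigon ∨
      ∃ w : SphPoly.E3, ‖w‖ = 1 ∧ P.carrier ⊆ SphPoly.openHemisphere w) := by
  obtain ⟨σ, hσ⟩ := P.exists_orientation hn hsimple side hangle
  have hsupp : ∀ i, ∃ w : SphPoly.E3, ‖w‖ = 1 ∧ P.edge i ⊆ SphPoly.greatCircle w ∧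
      P.carrier ⊆ SphPoly.closedHemisphere w := by
    intro i
    have hne : P.pole σ i ≠ 0 := by
      intro h
      have h1 := hσ i
      rw [← P.inner_pole, h, inner_zero_left] at h1
      exact lt_irrefl _ h1
    obtain ⟨w, hw, c, hc, hwc⟩ := SphPoly.exists_unit_smul hne
    refine ⟨w, hw, ?_, fun y hy => ⟨SphPoly.SphericalPolygon.norm_eq_one_of_mem_carrier hy, ?_⟩⟩
    · rintro _ ⟨t, -, rfl⟩
      exact ⟨(P.inner_point_velocity i t).2.1, by rw [hwc, P.inner_pole_point, mul_zero]⟩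
    · rw [hwc]
      exact mul_nonneg hc.le (SphPoly.SphericalPolygon.inner_pole_nonneg hsimple hσ i hy)
  refine ⟨?_, fun i => ⟨hsupp i, fun w hw hcar hedge =>
    SphPoly.SphericalPolygon.diff_edge_subset_openHemisphere hsimple hσ i hw hcar hedge⟩, ?_⟩
  · obtain ⟨w, hw, -, h⟩ := hsupp 0
    exact ⟨w, hw, h⟩
  · rcases hn.eq_or_lt with h2 | h3
    · exact Or.inl h2.symm
    right
    -- Every pole is nonnegative on the polygon, and an edge that misses `y` contributes a positive
    -- term.
    have hpos : ∀ y ∈ P.carrier, 0 < inner ℝ (∑ i, P.pole σ i) y := by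
      intro y hy
      rw [sum_inner]
      obtain ⟨i, hi⟩ := hsimple.exists_notMem_edge h3 y
      exact Finset.sum_pos' (fun j _ =>
        SphPoly.SphericalPolygon.inner_pole_nonneg hsimple hσ j hy)
        ⟨i, Finset.mem_univ i, SphPoly.SphericalPolygon.inner_pole_pos hsimple hσ i hy hi⟩
    have hv : P.point 0 0 ∈ P.carrier :=
      Set.mem_iUnion.2 ⟨0, 0, ⟨le_rfl, (P.length_pos 0).le⟩, rfl⟩
    have hne : ∑ i, P.pole σ i ≠ 0 := by
      intro h
      have h1 := hpos _ hv
      rw [h, inner_zero_left] at h1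
      exact lt_irrefl _ h1
    obtain ⟨w, hw, c, hc, hwc⟩ := SphPoly.exists_unit_smul hne
    exact ⟨w, hw, fun y hy => ⟨SphPoly.SphericalPolygon.norm_eq_one_of_mem_carrier hy, by
      rw [hwc]; exact mul_pos hc (hpos y hy)⟩⟩
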